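/- Let $f:\mathbb R^n\to\mathbb R$ and $g:\mathbb R^n\to\mathbb R^m$ be twice continuously differentiable, let $K\subseteq\mathbb R^m$ be closed, and put $C:=g^{-1}(K)$ and $L(x,\lambda):=f(x)+\langle\lambda,g(x)\rangle$. **Notation.** Sequences $t_k\downarrow 0$ consist of positive numbers tending to $0$. For a closed set $S$, a point $x\in S$ and a direction $u$: - $T_S(x)=\{v : \exists\, t_k\downarrow0,\ v_k\to v,\ x+t_kv_k\in S\ \forall k\}$ is the tangent cone; - $T^2_S(x;u)=\{w : \exists\, t_k\downarrow0,\ w_k\to w,\ x+t_ku+\tfrac12t_k^2w_k\in S\ \forall k\}$ is the outer second-order tangent set; - $T''_S(x;u)=\{w : \exists\, t_k\downarrow0,\ r_k\downarrow 0,\ w_k\to w,\ t_k/r_k\to0,\ x+t_ku+\tfrac12t_kr_kw_k\in S\ \forall k\}$ is the asymptotic second-order tangent cone; - $\hat N_S(y)=\{v:\limsup_{z\to y,\,z\in S\setminus\{y\}}\langle v,z-y\rangle/\|z-y\|\le0\}$ for $y\in S$, and $\hat N_S(y)=\emptyset$ for $y\notin S$; - $N_S(x;u)$ is the set of all $v$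 for which there are $t_k\downarrow0$, $u_k\to u$, $v_k\to v$ with $v_k\in\hat N_S(x+t_ku_k)$ for all $k$, and $N^c_S(x;u)$ is the closure of the convex hull of $N_S(x;u)$; - $\sigma_S(\lambda)=\sup_{u\in S}\langle\lambda,u\rangle\in[-\infty,+\infty]$ for any set $S$. Let $\bar x\in C$ and $d\in T_C(\bar x)$. Suppose that $\bar x$ is a local minimizer of $f$ over $C$ in direction $d$, that is, there are $\rho,\delta>0$ such that $f(x)\ge f(\bar x)$ for all $x\in C$ for which $w:=x-\bar x$ satisfies $\|w\|\le\delta$ and $\big\|\,\|d\|w-\|w\|d\,\big\|\le\rho\|w\|\|d\|$. Suppose further that $\nabla f(\bar x)d=0$ and that the directional Robinson constraint qualification holds in direction $d$: $$\nabla g(\bar x)^T\lambda=0,\quad \lambda\in N^c_K(g(\bar x);\nabla g(\bar x)d)\ \Longrightarrow\ \lambda=0 .$$ Let $\Lambda^c(\bar x;d)=\{\lambda\in\mathbb R^m:\lambda\in N^c_K(g(\bar x);\nabla g(\bar x)d),\ \nabla_xL(\bar x,\lambda)=0\}$ be the set of directional Clarke multipliers. Then: (i) For every nonempty convex set $K(d)\subseteq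 T''_K(g(\bar x);\nabla g(\bar x)d)$ there exists $\lambda\in\Lambda^c(\bar x;d)$ such that $\sigma_{K(d)}(\lambda)\le0$. (ii) If $T^2_K(g(\bar x);\nabla g(\bar x)d)\ne\emptyset$, then for every nonempty convex set $K(d)\subseteq T^2_K(g(\bar x);\nabla g(\bar x)d)$ there exists $\lambda\in\Lambda^c(\bar x;d)$ such that $\nabla^2_{xx}L(\bar x,\lambda)(d,d)-\sigma_{K(d)}(\lambda)\ge0$. -/

import Mathlib

open Set Filter Topology

noncomputable section

namespace DirOpt

section Cones

variable {E : Type*} [NormedAddCommGroup E] [InnerProductSpace ℝ E]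

/-- The Bouligand (contingent) tangent cone `T_S(x)`. -/
def tangentCone (S : Set E) (x : E) : Set E :=
  {d | ∃ (t : ℕ → ℝ) (e : ℕ → E), (∀ k, 0 < t k) ∧ Tendsto t atTop (𝓝 0) ∧
    Tendsto e atTop (𝓝 d) ∧ ∀ k, x + t k • e k ∈ S}

/-- The (outer) second-order tangent set `T²_S(x; d)`. -/
def secondOrderTangentSet (S : Set E) (x d : E) : Set E :=
  {w | ∃ (t : ℕ → ℝ) (u : ℕ → E), (∀ k, 0 < t k) ∧ Tendsto t atTop (𝓝 0) ∧
    Tendsto u atTop (𝓝 w) ∧ ∀ k, x + t k • d + ((1 / 2 : ℝ) * t k ^ 2) • u k ∈ S}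

/-- The asymptotic second-order tangent cone `T''_S(x; d)`. -/
def asymptoticTangentCone (S : Set E) (x d : E) : Set E :=
  {w | ∃ (t r : ℕ → ℝ) (u : ℕ → E), (∀ k, 0 < t k) ∧ (∀ k, 0 < r k) ∧
    Tendsto t atTop (𝓝 0) ∧ Tendsto r atTop (𝓝 0) ∧
    Tendsto (fun k => t k / r k) atTop (𝓝 0) ∧ Tendsto u atTop (𝓝 w) ∧
    ∀ k, x + t k • d + ((1 / 2 : ℝ) * t k * r k) • u k ∈ S}

/-- The Fréchet normal cone `N̂_S(x)`, empty for `x ∉ S`. The last clause says that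
`limsup ⟪v, y - x⟫ / ‖y - x‖ ≤ 0` as `y → x`, `y ∈ S`, `y ≠ x`. -/
def frechetNormalCone (S : Set E) (x : E) : Set E :=
  {v | x ∈ S ∧ ∀ ε : ℝ, 0 < ε → ∀ᶠ y in 𝓝[S] x, inner ℝ v (y - x) ≤ ε * ‖y - x‖}

/-- The limiting normal cone `N_S(x; d)` in direction `d`: the outer limit of
`N̂_S(x + t d')` as `t ↓ 0`, `d' → d`. -/
def dirNormalCone (S : Set E) (x d : E) : Set E :=
  {v | ∃ (t : ℕ → ℝ) (e u : ℕ → E), (∀ k, 0 < t k) ∧ Tendsto t atTop (𝓝 0) ∧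
    Tendsto e atTop (𝓝 d) ∧ Tendsto u atTop (𝓝 v) ∧
    ∀ k, u k ∈ frechetNormalCone S (x + t k • e k)}

/-- The directional Clarke normal cone `Nᶜ_S(x; d) = cl co N_S(x; d)`. -/
def dirClarkeNormalCone (S : Set E) (x d : E) : Set E :=
  closure (convexHull ℝ (dirNormalCone S x d))

/-- The support function `σ_S(l) = sup_{u ∈ S} ⟪l, u⟫`, with extended real values. -/
def supportFun (S : Set E) (l : E) : EReal :=
  ⨆ u ∈ S, ((inner ℝ l u : ℝ) : EReal)

/-- The directional neighbourhood `V_{ρ,δ}(d)`. -/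
def dirNhd (ρ δ : ℝ) (d : E) : Set E :=
  {w | ‖w‖ ≤ δ ∧ ‖‖d‖ • w - ‖w‖ • d‖ ≤ ρ * ‖w‖ * ‖d‖}

/-- `x` is a local optimal solution of `min f` over `C` in direction `d`. -/
def IsDirLocalMin (f : E → ℝ) (C : Set E) (x d : E) : Prop :=
  x ∈ C ∧ ∃ ρ δ : ℝ, 0 < ρ ∧ 0 < δ ∧ ∀ y ∈ C, y - x ∈ dirNhd ρ δ d → f x ≤ f y

end Cones

section Problem

variable {E F : Type*} [NormedAddCommGroup E] [InnerProductSpace ℝ E] [CompleteSpace E]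
  [NormedAddCommGroup F] [InnerProductSpace ℝ F] [CompleteSpace F]

/-- The Lagrangian `L(x, l) = f(x) + ⟪l, g(x)⟫`. -/
def lagrangian (f : E → ℝ) (g : E → F) (x : E) (l : F) : ℝ :=
  f x + inner ℝ l (g x)

/-- The second derivative `∇²ₓₓ L(x, l)(d, d)` of the Lagrangian in its first argument. -/
def lagrangianHess (f : E → ℝ) (g : E → F) (x : E) (l : F) (d : E) : ℝ :=
  fderiv ℝ (fderiv ℝ (fun y => lagrangian f g y l)) x d d

/-- The directional Clarke multipliers `Λᶜ(x; d)`. -/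
def clarkeMultipliers (f : E → ℝ) (g : E → F) (K : Set F) (x d : E) : Set F :=
  {l | l ∈ dirClarkeNormalCone K (g x) (fderiv ℝ g x d) ∧
    fderiv ℝ (fun y => lagrangian f g y l) x = 0}

/-- The directional Robinson constraint qualification in direction `d`. -/
def DirRCQ (g : E → F) (K : Set F) (x d : E) : Prop :=
  ∀ l ∈ dirClarkeNormalCone K (g x) (fderiv ℝ g x d),
    ContinuousLinearMap.adjoint (fderiv ℝ g x) l = 0 → l = 0

end Problem

end DirOpt

end

/-! Both claims are one statement about arcs `g x + t q + s U` in `K`, with `q = ∇g(x)d`, `s = o(t)`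
and `t² / (2s) → θ`: `θ = 0` gives (i) and `θ = 1` gives (ii).

Primal part (`nonneg_of_isArcTangent`). Let `w` be an arc tangent and `p` polar to the directional
normal cone. Leaving `K` along `p` from points of the arc costs only distance `o(s)`, because
normals at the nearby projections are almost directional normals and so make an almost nonpositive
product with `p` (`tendsto_infDist_div_of_mem_polar`). If `∇g(x)v + θ∇²g(x)(d,d) = w + p`, then `x +
t d + s v` satisfies the constraint up to `o(s)`. The qualification lets an `o(s)` displacement
restore feasibility (`exists_feasible_correction`). Directional minimality and a Taylor expansion
then give `0 ≤ ∇f(x)v + θ∇²f(x)(d,d)`.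

Dual part (`exists_multiplier`). This is nonnegativity of a convex program in `(v, w, p)`, with `w`
ranging over the given convex set. Separation yields one multiplier valid for all `w`, and the
bipolar theorem places it in the Clarke normal cone. Different `w` may come from unrelated
sequences: only the primal inequality, one `w` at a time, sees them. -/

namespace DirOpt

/-! ### Convex separation and Lagrange duality -/

section Separation

/-- In finite dimensions a nonempty convex set that misses the origin lies in a closed
half-space, without any assumption on its interior. -/
theorem exists_ne_zero_forall_nonneg_of_convex {V : Type*} [NormedAddCommGroup V]
    [NormedSpace ℝ V] [FiniteDimensional ℝ V] {M : Set V} (hM : Convex ℝ M)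
    (hne : M.Nonempty) (h0 : (0 : V) ∉ M) :
    ∃ φ : StrongDual ℝ V, φ ≠ 0 ∧ ∀ m ∈ M, 0 ≤ φ m := by
  -- If `M` spans, the cone it generates has interior points even when `M` lies in a hyperplane off
  -- the origin. Otherwise a nonzero functional vanishing on the span will do.
  by_cases hspan : Submodule.span ℝ M = ⊤
  · set P : Set V := ((ConvexCone.hull ℝ M : ConvexCone ℝ V) : Set V) with hP
    have hPc : Convex ℝ P := (ConvexCone.hull ℝ M).convex
    have hMP : M ⊆ P := ConvexCone.subset_hull
    have h0P : (0 : V) ∉ P := by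
      intro h
      rw [hP, ConvexCone.coe_hull_of_convex hM] at h
      obtain ⟨c, hc, y, hy, hcy⟩ := h
      rcases smul_eq_zero.1 hcy with h | h
      · exact hc.ne' h
      · exact h0 (h ▸ hy)
    have hPne : P.Nonempty := hne.mono hMP
    have hvs : vectorSpan ℝ P = ⊤ := by
      rw [eq_top_iff, ← hspan, Submodule.span_le]
      intro m hm
      have h2 : (2 : ℝ) • m ∈ P := (ConvexCone.hull ℝ M).smul_mem two_pos (hMP hm)
      have := vsub_mem_vectorSpan ℝ h2 (hMP hm)
      rwa [vsub_eq_sub, two_smul, add_sub_cancel_right] at this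
    have hint : (interior P).Nonempty := by
      rw [hPc.interior_nonempty_iff_affineSpan_eq_top,
        AffineSubspace.affineSpan_eq_top_iff_vectorSpan_eq_top_of_nonempty _ _ _ hPne]
      exact hvs
    obtain ⟨φ, hφ, hle⟩ := geometric_hahn_banach_of_nonempty_interior_point hPc
      (fun h => h0P (interior_subset h)) hint
    refine ⟨-φ, neg_ne_zero.2 hφ, fun m hm => ?_⟩
    have := hle m (hMP hm)
    simp only [map_zero] at this
    simpa using this
  · obtain ⟨φ, hφ, hle⟩ := Submodule.exists_le_ker_of_lt_top _ (lt_top_iff_ne_top.2 hspan)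
    refine ⟨LinearMap.toContinuousLinearMap φ, ?_, fun m hm => ?_⟩
    · intro h
      exact hφ (by simpa using h)
    · have : φ m = 0 := hle (Submodule.subset_span hm)
      simp [this]

variable {E F : Type*} [NormedAddCommGroup E] [NormedSpace ℝ E]
  [NormedAddCommGroup F] [InnerProductSpace ℝ F]

/-- The polar cone of a set. -/
def polar (N : Set F) : Set F := {p | ∀ u ∈ N, inner ℝ u p ≤ 0}

theorem zero_mem_polar (N : Set F) : (0 : F) ∈ polar N := fun u _ => by simp

theorem convex_polar (N : Set F) : Convex ℝ (polar N) := by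
  intro p hp q hq α β hα hβ _ u hu
  rw [inner_add_right, inner_smul_right, inner_smul_right]
  nlinarith [hp u hu, hq u hu]

theorem smul_mem_polar {N : Set F} {p : F} (hp : p ∈ polar N) {c : ℝ} (hc : 0 ≤ c) :
    c • p ∈ polar N := fun u hu => by
  rw [inner_smul_right]
  exact mul_nonpos_of_nonneg_of_nonpos hc (hp u hu)

/-- The bipolar theorem for a cone that need not be convex. -/
theorem mem_closure_convexHull_of_mem_polar_polar [CompleteSpace F] {N : Set F}
    (h0 : (0 : F) ∈ N) (hcone : ∀ c : ℝ, 0 < c → ∀ u ∈ N, c • u ∈ N) {l : F}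
    (hl : l ∈ polar (polar N)) : l ∈ closure (convexHull ℝ N) := by
  by_contra hnot
  obtain ⟨φ, s, hlt, hs⟩ := geometric_hahn_banach_closed_point
    (convex_convexHull ℝ N).closure isClosed_closure hnot
  have hN : ∀ u ∈ N, φ u < s := fun u hu => hlt u (subset_closure (subset_convexHull ℝ N hu))
  have hs0 : 0 < s := by simpa using hN 0 h0
  set p : F := (InnerProductSpace.toDual ℝ F).symm φ with hp
  have hpφ : ∀ u, inner ℝ p u = φ u := fun u => by
    rw [hp, InnerProductSpace.toDual_symm_apply]
  have hpp : p ∈ polar N := by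
    intro u hu
    rw [real_inner_comm, hpφ]
    by_contra! hpos
    have := hN _ (hcone (s / φ u) (div_pos hs0 hpos) u hu)
    rw [map_smul, smul_eq_mul, div_mul_cancel₀ _ hpos.ne'] at this
    exact lt_irrefl _ this
  have := hl p hpp
  rw [hpφ] at this
  linarith

/-- Duality for `min c v + a` subject to `A v + b ∈ W + polar N`: if the optimal value is
nonnegative and a Robinson-type qualification holds, there is a Lagrange multiplier. -/
theorem exists_multiplier [FiniteDimensional ℝ F] (A : E →L[ℝ] F) (c : E →L[ℝ] ℝ) (a : ℝ)
    (b : F) (N W : Set F) (hW : Convex ℝ W) (hWne : W.Nonempty)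
    (hval : ∀ v, ∀ w ∈ W, ∀ p ∈ polar N, A v + b = w + p → 0 ≤ c v + a)
    (hcq : ∀ l ∈ polar (polar N), (∀ v, inner ℝ l (A v) = 0) → l = 0) :
    ∃ l ∈ polar (polar N), (∀ v, c v + inner ℝ l (A v) = 0) ∧
      ∀ w ∈ W, inner ℝ l w ≤ a + inner ℝ l b := by
  have : CompleteSpace F := FiniteDimensional.complete ℝ F
  -- Pairs of constraint residual and objective plus positive slack; the origin is excluded exactly
  -- because the optimal value is nonnegative.
  set M : Set (F × ℝ) := {z | ∃ v, ∃ w ∈ W, ∃ p ∈ polar N, ∃ s : ℝ, 0 < s ∧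
    z = (A v + b - w - p, c v + a + s)} with hMdef
  obtain ⟨w₀, hw₀⟩ := hWne
  have hM : Convex ℝ M := by
    rintro _ ⟨v, w, hw, p, hp, s, hs, rfl⟩ _ ⟨v', w', hw', p', hp', s', hs', rfl⟩ α β hα hβ hαβ
    refine ⟨α • v + β • v', α • w + β • w', hW hw hw' hα hβ hαβ, α • p + β • p',
      convex_polar N hp hp' hα hβ hαβ, α * s + β * s', ?_, ?_⟩
    · rcases hα.eq_or_lt with h | h
      · have : β = 1 := by linarith
        subst h; subst this; linarith
      · have := mul_pos h hs
        have := mul_nonneg hβ hs'.le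
        linarith
    · have hb : b = α • b + β • b := by rw [← add_smul, hαβ, one_smul]
      have ha : a = α * a + β * a := by rw [← add_mul, hαβ, one_mul]
      refine Prod.ext ?_ ?_
      · simp only [Prod.fst_add, Prod.smul_fst, map_add, map_smul]
        conv_rhs => rw [hb]
        module
      · simp only [Prod.snd_add, Prod.smul_snd, map_add, map_smul, smul_eq_mul]
        linear_combination (-1 : ℝ) * ha
  have hMne : M.Nonempty := ⟨_, 0, w₀, hw₀, 0, zero_mem_polar N, 1, one_pos, rfl⟩
  have h0 : (0 : F × ℝ) ∉ M := by
    rintro ⟨v, w, hw, p, hp, s, hs, h⟩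
    have h1 : A v + b - w - p = 0 := (congrArg Prod.fst h).symm
    have h2 : c v + a + s = 0 := (congrArg Prod.snd h).symm
    have := hval v w hw p hp (by rwa [sub_sub, sub_eq_zero] at h1)
    linarith
  obtain ⟨φ, hφ, hpos⟩ := exists_ne_zero_forall_nonneg_of_convex hM hMne h0
  set μ : ℝ := φ (0, 1) with hμ
  set l : F := (InnerProductSpace.toDual ℝ F).symm (φ.comp (ContinuousLinearMap.inl ℝ F ℝ))
    with hl
  have hφeq : ∀ y r, φ (y, r) = inner ℝ l y + r * μ := by
    intro y r
    rw [hl, InnerProductSpace.toDual_symm_apply, hμ, ← smul_eq_mul, ← map_smul,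
      ContinuousLinearMap.comp_apply, ← map_add]
    simp
  have key : ∀ v, ∀ w ∈ W, ∀ p ∈ polar N, ∀ s : ℝ, 0 < s →
      0 ≤ inner ℝ l (A v) + inner ℝ l b - inner ℝ l w - inner ℝ l p + (c v + a + s) * μ := by
    intro v w hw p hp s hs
    have := hpos _ ⟨v, w, hw, p, hp, s, hs, rfl⟩
    rwa [hφeq, inner_sub_right, inner_sub_right, inner_add_right] at this
  -- An affine function nonnegative on a ray has nonnegative slope. Scaling the slack, `p` and `v`
  -- in turn gives the sign of `μ`, polarity of `l` and stationarity.
  have affine_nonneg : ∀ α β : ℝ, (∀ r : ℝ, 0 < r → 0 ≤ α + r * β) → 0 ≤ β := by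
    intro α β h
    by_contra! hβ
    have := h ((|α| + 1) / (-β)) (div_pos (by positivity) (by linarith))
    have e : (|α| + 1) / (-β) * β = -(|α| + 1) := by
      rw [div_neg, neg_mul, div_mul_cancel₀ _ hβ.ne]
    rw [e] at this
    linarith [le_abs_self α]
  have hμ0 : 0 ≤ μ := by
    refine affine_nonneg (inner ℝ l b - inner ℝ l w₀ + a * μ) μ fun r hr => ?_
    have := key 0 w₀ hw₀ 0 (zero_mem_polar N) r hr
    simp only [map_zero, inner_zero_right] at this
    linarith
  have hlp : ∀ p ∈ polar N, inner ℝ l p ≤ 0 := by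
    intro p hp
    have : 0 ≤ -inner ℝ l p := by
      refine affine_nonneg (inner ℝ l b - inner ℝ l w₀ + (a + 1) * μ) _ fun r hr => ?_
      have := key 0 w₀ hw₀ (r • p) (smul_mem_polar hp hr.le) 1 one_pos
      simp only [map_zero, inner_zero_right, inner_smul_right] at this
      linarith
    linarith
  have hstat_le : ∀ v, 0 ≤ inner ℝ l (A v) + c v * μ := by
    intro v
    refine affine_nonneg (inner ℝ l b - inner ℝ l w₀ + (a + 1) * μ) _ fun r hr => ?_
    have := key (r • v) w₀ hw₀ 0 (zero_mem_polar N) 1 one_pos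
    simp only [map_smul, inner_zero_right, inner_smul_right, smul_eq_mul] at this
    linarith
  have hstat : ∀ v, inner ℝ l (A v) + c v * μ = 0 := by
    intro v
    refine le_antisymm ?_ (hstat_le v)
    have := hstat_le (-v)
    simp only [map_neg, inner_neg_right] at this
    linarith
  have hpol : ∀ r : ℝ, 0 ≤ r → r • l ∈ polar (polar N) := fun r hr => by
    refine smul_mem_polar (fun p hp => ?_) hr
    rw [real_inner_comm]
    exact hlp p hp
  -- With `μ = 0`, `l` would annihilate the range of `A`, so the qualification would force the
  -- separating functional to vanish.
  have hμpos : 0 < μ := by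
    refine lt_of_le_of_ne hμ0 fun h => hφ ?_
    have hl0 : l = 0 := by
      refine hcq l (by simpa using hpol 1 zero_le_one) fun v => ?_
      have := hstat v
      rwa [← h, mul_zero, add_zero] at this
    ext z
    · simp [hφeq, hl0]
    · simp [hφeq, hl0, ← h]
  refine ⟨μ⁻¹ • l, hpol _ (inv_nonneg.2 hμ0), fun v => ?_, fun w hw => ?_⟩
  · rw [real_inner_smul_left]
    have := hstat v
    field_simp
    linarith
  · rw [real_inner_smul_left, real_inner_smul_left]
    have h1 : 0 ≤ inner ℝ l b - inner ℝ l w + a * μ := by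
      refine le_of_forall_pos_le_add fun ε hε => ?_
      have := key 0 w hw 0 (zero_mem_polar N) (ε / μ) (div_pos hε hμpos)
      simp only [map_zero, inner_zero_right, add_mul, div_mul_cancel₀ _ hμpos.ne'] at this
      linarith
    have h2 := mul_nonneg (inv_nonneg.2 hμ0) h1
    have e : μ⁻¹ * (inner ℝ l b - inner ℝ l w + a * μ)
        = a + μ⁻¹ * inner ℝ l b - μ⁻¹ * inner ℝ l w := by
      field_simp
      ring
    linarith

end Separation

/-! ### Taylor expansion along parabolic arcs -/

section Taylor

variable {E G : Type*} [NormedAddCommGroup E] [NormedSpace ℝ E]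
  [NormedAddCommGroup G] [NormedSpace ℝ G]

open Asymptotics in
/-- Second-order Taylor expansion with Peano remainder. -/
theorem isLittleO_taylor_two {h : E → G} (hh : ContDiff ℝ 2 h) (x : E) :
    (fun w => h (x + w) - h x - fderiv ℝ h x w - (1 / 2 : ℝ) • fderiv ℝ (fderiv ℝ h) x w w)
      =o[𝓝 0] fun w => ‖w‖ ^ 2 := by
  set A := fderiv ℝ h x with hA
  set B := fderiv ℝ (fderiv ℝ h) x with hB
  -- Symmetry makes `B w` the derivative of `½ B w w`, so the remainder has derivative `o(‖w‖)` and
  -- the mean value inequality applies.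
  have hsymm : ∀ v w, B v w = B w v := fun v w =>
    (hh.contDiffAt.isSymmSndFDerivAt (by simp)) v w
  have hd1 : ∀ y, HasFDerivAt h (fderiv ℝ h y) y := fun y =>
    (hh.differentiable (by norm_num) y).hasFDerivAt
  have hd2 : HasFDerivAt (fderiv ℝ h) B x :=
    ((hh.fderiv_right (m := 1) (by norm_num)).differentiable (by norm_num) x).hasFDerivAt
  set R : E → G := fun w => h (x + w) - h x - A w - (1 / 2 : ℝ) • B w w with hR
  have hRd : ∀ w, HasFDerivAt R (fderiv ℝ h (x + w) - A - B w) w := by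
    intro w
    have h1 : HasFDerivAt (fun w => h (x + w)) (fderiv ℝ h (x + w)) w := by
      have := (hd1 (x + w)).comp w ((hasFDerivAt_id w).const_add x)
      rw [ContinuousLinearMap.comp_id] at this
      exact this
    have h2 : HasFDerivAt (fun w => (1 / 2 : ℝ) • B w w) (B w) w := by
      have := ((B.hasFDerivAt (x := w)).clm_apply (hasFDerivAt_id w)).const_smul (1 / 2 : ℝ)
      refine this.congr_fderiv ?_
      ext v
      simp only [id, _root_.smul_apply, _root_.add_apply,
        ContinuousLinearMap.comp_apply, ContinuousLinearMap.flip_apply,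
        ContinuousLinearMap.id_apply, hsymm v w]
      module
    have h3 := ((h1.sub_const (h x)).sub A.hasFDerivAt).sub h2
    exact h3
  rw [isLittleO_iff]
  intro ε hε
  have ho := (hasFDerivAt_iff_isLittleO_nhds_zero.1 hd2).def hε
  obtain ⟨δ, hδ, hball⟩ := Metric.eventually_nhds_iff.1 ho
  refine Metric.eventually_nhds_iff.2 ⟨δ, hδ, fun w hw => ?_⟩
  rw [dist_zero_right] at hw
  have hmv := Convex.norm_image_sub_le_of_norm_fderiv_le (𝕜 := ℝ) (f := R) (C := ε * ‖w‖)
    (s := Metric.closedBall 0 ‖w‖) (x := 0) (y := w)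
    (fun y _ => (hRd y).differentiableAt) (fun y hy => ?_) (convex_closedBall _ _)
    (by simp) (by simp)
  · have hR0 : R 0 = 0 := by simp [hR]
    rw [hR0, sub_zero, sub_zero] at hmv
    rw [norm_pow, norm_norm, pow_two, ← mul_assoc]
    exact hmv
  · rw [mem_closedBall_zero_iff] at hy
    rw [(hRd y).fderiv]
    have := hball (y := y) (by rw [dist_zero_right]; linarith)
    exact this.trans (by gcongr)

open Asymptotics in
/-- Limit of second-order difference quotients along a parabolic arc
`x + t d + s v` with `t² / 2s → θ`. -/
theorem tendsto_second_order_quotient {h : E → G} (hh : ContDiff ℝ 2 h) {x d v : E} {θ : ℝ}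
    {t s : ℕ → ℝ} {V : ℕ → E} (ht : ∀ k, 0 < t k) (hs : ∀ k, 0 < s k)
    (ht0 : Tendsto t atTop (𝓝 0)) (hst : Tendsto (fun k => s k / t k) atTop (𝓝 0))
    (hθ : Tendsto (fun k => 1 / 2 * t k ^ 2 / s k) atTop (𝓝 θ)) (hV : Tendsto V atTop (𝓝 v)) :
    Tendsto (fun k => (s k)⁻¹ • (h (x + t k • d + s k • V k) - h x - t k • fderiv ℝ h x d))
      atTop (𝓝 (fderiv ℝ h x v + θ • fderiv ℝ (fderiv ℝ h) x d d)) := by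
  set A := fderiv ℝ h x with hA
  set B := fderiv ℝ (fderiv ℝ h) x with hB
  set D : ℕ → E := fun k => d + (s k / t k) • V k with hD
  have hDlim : Tendsto D atTop (𝓝 d) := by
    simpa using tendsto_const_nhds.add (hst.smul hV)
  have hw : ∀ k, t k • d + s k • V k = t k • D k := by
    intro k
    rw [hD, smul_add, smul_smul, mul_div_cancel₀ _ (ht k).ne']
  have hwlim : Tendsto (fun k => t k • D k) atTop (𝓝 0) := by
    simpa using ht0.smul hDlim
  -- Since `t² / (2s)` converges, the Peano remainder `o(t²)` is also `o(s)`.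
  have hO : (fun k => ‖t k • D k‖ ^ 2) =O[atTop] s := by
    refine isBigO_of_div_tendsto_nhds (Eventually.of_forall fun k hk => absurd hk (hs k).ne')
      (2 * θ * ‖d‖ ^ 2) ?_
    refine ((hθ.const_mul 2).mul (hDlim.norm.pow 2)).congr fun k => ?_
    rw [Pi.div_apply, norm_smul, mul_pow, Real.norm_eq_abs, sq_abs]
    ring
  have hrem := ((isLittleO_taylor_two hh x).comp_tendsto hwlim).trans_isBigO hO
  have hrem0 := hrem.tendsto_inv_smul_nhds_zero
  have hmain : Tendsto (fun k => A (V k) + (1 / 2 * t k ^ 2 / s k) • B (D k) (D k)) atTop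
      (𝓝 (A v + θ • B d d)) :=
    ((A.continuous.tendsto v).comp hV).add
      (hθ.smul (((B.continuous.clm_apply continuous_id).tendsto d).comp hDlim))
  have := hrem0.add hmain
  rw [zero_add] at this
  refine this.congr fun k => ?_
  simp only [Function.comp_apply]
  rw [add_assoc x, hw k]
  have e1 : A (t k • D k) = t k • A d + s k • A (V k) := by
    rw [← hw k, map_add, map_smul, map_smul]
  have e2 : B (t k • D k) (t k • D k) = (t k ^ 2) • B (D k) (D k) := by
    rw [map_smul, map_smul, _root_.smul_apply, smul_smul, pow_two]
  rw [e1, e2]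
  have hs' := (hs k).ne'
  rw [smul_sub _ _ ((1 / 2 : ℝ) • _), sub_add_eq_sub_sub, smul_sub _ _ (s k • _), smul_smul _ (s k),
    inv_mul_cancel₀ hs', one_smul, smul_smul, smul_smul,
    show (s k)⁻¹ * (1 / 2) * t k ^ 2 = 1 / 2 * t k ^ 2 / s k by ring]
  abel

end Taylor

/-! ### Fréchet and directional normals -/

section Normals

variable {F : Type*} [NormedAddCommGroup F] [InnerProductSpace ℝ F]

theorem smul_mem_frechetNormalCone {S : Set F} {y u : F} (hu : u ∈ frechetNormalCone S y)
    {c : ℝ} (hc : 0 < c) : c • u ∈ frechetNormalCone S y := by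
  refine ⟨hu.1, fun ε hε => ?_⟩
  filter_upwards [hu.2 (ε / c) (div_pos hε hc)] with z hz
  rw [real_inner_smul_left]
  calc c * inner ℝ u (z - y) ≤ c * (ε / c * ‖z - y‖) := by gcongr
    _ = ε * ‖z - y‖ := by field_simp

theorem smul_mem_dirNormalCone {S : Set F} {y q u : F} (hu : u ∈ dirNormalCone S y q)
    {c : ℝ} (hc : 0 < c) : c • u ∈ dirNormalCone S y q := by
  obtain ⟨t, e, v, ht, ht0, he, hv, hn⟩ := hu
  exact ⟨t, e, fun k => c • v k, ht, ht0, he, hv.const_smul c,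
    fun k => smul_mem_frechetNormalCone (hn k) hc⟩

/-- Tangency of `q` supplies points of `S` at which the zero normal is available; the bipolar
theorem needs this. -/
theorem zero_mem_dirNormalCone {S : Set F} {y q : F} (hq : q ∈ tangentCone S y) :
    (0 : F) ∈ dirNormalCone S y q := by
  obtain ⟨t, e, ht, ht0, he, hS⟩ := hq
  refine ⟨t, e, fun _ => 0, ht, ht0, he, tendsto_const_nhds, fun k => ⟨hS k, fun ε hε => ?_⟩⟩
  refine Eventually.of_forall fun z => ?_
  rw [inner_zero_left]
  positivity

/-- Expanding `‖z - w‖² ≥ ‖z - π‖²` gives `2⟪z - π, w - π⟫ ≤ ‖w - π‖²`, which is `o(‖w - π‖)`. -/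
theorem sub_mem_frechetNormalCone_of_infDist_eq {S : Set F} {z π : F} (hπ : π ∈ S)
    (h : Metric.infDist z S = dist z π) : z - π ∈ frechetNormalCone S π := by
  refine ⟨hπ, fun ε hε => ?_⟩
  have hnear : ∀ᶠ w in 𝓝[S] π, dist w π < ε :=
    nhdsWithin_le_nhds (Metric.ball_mem_nhds π hε)
  filter_upwards [hnear, self_mem_nhdsWithin] with w hw hwS
  rw [dist_eq_norm] at hw
  have h1 : ‖z - π‖ ≤ ‖z - w‖ := by
    rw [← dist_eq_norm, ← dist_eq_norm, ← h]
    exact Metric.infDist_le_dist_of_mem hwS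
  have h2 : ‖z - w‖ ^ 2 = ‖z - π‖ ^ 2 - 2 * inner ℝ (z - π) (w - π) + ‖w - π‖ ^ 2 := by
    rw [← norm_sub_sq_real, sub_sub_sub_cancel_right]
  have h3 : ‖z - π‖ ^ 2 ≤ ‖z - w‖ ^ 2 := by gcongr
  nlinarith [norm_nonneg (w - π)]

theorem unit_mem_frechetNormalCone_of_infDist_eq {S : Set F} {z π : F} (hπ : π ∈ S)
    (h : Metric.infDist z S = dist z π) (hne : z ≠ π) :
    ‖z - π‖⁻¹ • (z - π) ∈ frechetNormalCone S π ∧ ‖‖z - π‖⁻¹ • (z - π)‖ = 1 :=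
  ⟨smul_mem_frechetNormalCone (sub_mem_frechetNormalCone_of_infDist_eq hπ h)
    (inv_pos.2 (norm_pos_iff.2 (sub_ne_zero.2 hne))),
    by
    rw [norm_smul, norm_inv, norm_norm, inv_mul_cancel₀ (norm_ne_zero_iff.2 (sub_ne_zero.2 hne))]⟩

/-- A continuous function that is positive on the unit directional normals is bounded below by
a positive constant on the unit Fréchet normals at nearby points in nearby directions. -/
theorem exists_pos_forall_lt_of_pos_on_dirNormalCone [FiniteDimensional ℝ F] {S : Set F}
    {y q : F} {φ : F → ℝ} (hφ : Continuous φ)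
    (hpos : ∀ u ∈ dirNormalCone S y q, ‖u‖ = 1 → 0 < φ u) :
    ∃ δ : ℝ, 0 < δ ∧ ∀ t e u, 0 < t → t < δ → ‖e - q‖ < δ →
      u ∈ frechetNormalCone S (y + t • e) → ‖u‖ = 1 → δ < φ u := by
  -- Failure for every `δ = 1/(k+1)` gives unit normals with a convergent subsequence, whose limit
  -- is a unit directional normal with `φ ≤ 0`.
  by_contra! hcon
  have hcon' := fun k : ℕ => hcon (1 / ((k : ℝ) + 1)) (by positivity)
  choose t e u ht htδ heδ hu hu1 hφu using hcon'
  have : ProperSpace F := FiniteDimensional.proper ℝ F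
  obtain ⟨a, ha, ψ, hψ, hlim⟩ := (isCompact_sphere (0 : F) 1).tendsto_subseq
    (x := u) (fun k => by simp [hu1 k])
  have h0 : Tendsto (fun k : ℕ => 1 / ((k : ℝ) + 1)) atTop (𝓝 0) :=
    tendsto_one_div_add_atTop_nhds_zero_nat
  have ht0 : Tendsto t atTop (𝓝 0) :=
    squeeze_zero (fun k => (ht k).le) (fun k => (htδ k).le) h0
  have he : Tendsto e atTop (𝓝 q) :=
    tendsto_iff_norm_sub_tendsto_zero.2
      (squeeze_zero (fun _ => norm_nonneg _) (fun k => (heδ k).le) h0)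
  have hmem : a ∈ dirNormalCone S y q :=
    ⟨t ∘ ψ, e ∘ ψ, u ∘ ψ, fun k => ht _, ht0.comp hψ.tendsto_atTop,
      he.comp hψ.tendsto_atTop, hlim, fun k => hu _⟩
  have hle : φ a ≤ 0 := le_of_tendsto_of_tendsto' ((hφ.tendsto a).comp hlim)
    (h0.comp hψ.tendsto_atTop) fun k => hφu (ψ k)
  exact absurd (hpos a hmem (by simpa using ha)) (not_lt.2 hle)

end Normals

/-! ### Moving off the set in polar directions -/

section Approximation

variable {F : Type*} [NormedAddCommGroup F] [InnerProductSpace ℝ F]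

/-- Distance growth along a segment that leaves `K` in a direction which is almost polar to the
normals at the projections onto `K`. -/
theorem sq_infDist_add_smul_le [ProperSpace F] {K : Set F} (hK : IsClosed K) {z p : F} {s ε : ℝ}
    (hz : z ∈ K) (hs : 0 ≤ s) (hε : 0 ≤ ε)
    (H : ∀ τ, 0 ≤ τ → τ ≤ s → ∀ π ∈ K, Metric.infDist (z + τ • p) K = dist (z + τ • p) π →
      inner ℝ (z + τ • p - π) p ≤ ε * ‖z + τ • p - π‖) :
    Metric.infDist (z + s • p) K ^ 2 ≤ 2 * ε * ‖p‖ * s ^ 2 := by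
  have hdist : ∀ τ, 0 ≤ τ → Metric.infDist (z + τ • p) K ≤ τ * ‖p‖ := by
    intro τ hτ
    refine (Metric.infDist_le_dist_of_mem hz).trans ?_
    rw [dist_eq_norm, add_sub_cancel_left, norm_smul, Real.norm_of_nonneg hτ]
  -- Euler step for the squared distance: the projection of the current point is the competitor for
  -- the next. Over `N + 1` equal steps the `η²` errors sum to `O(1/(N+1))`.
  have hstep : ∀ τ η, 0 ≤ τ → τ ≤ s → 0 ≤ η → Metric.infDist (z + (τ + η) • p) K ^ 2 ≤
      Metric.infDist (z + τ • p) K ^ 2 + 2 * η * ε * (s * ‖p‖) + η ^ 2 * ‖p‖ ^ 2 := by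
    intro τ η hτ hτs hη
    obtain ⟨π, hπ, hdπ⟩ := hK.exists_infDist_eq_dist ⟨z, hz⟩ (z + τ • p)
    have h1 := H τ hτ hτs π hπ hdπ
    have h2 : Metric.infDist (z + (τ + η) • p) K ≤ ‖(z + τ • p - π) + η • p‖ := by
      refine (Metric.infDist_le_dist_of_mem hπ).trans_eq ?_
      rw [dist_eq_norm]
      congr 1
      module
    have h3 : Metric.infDist (z + (τ + η) • p) K ^ 2 ≤ ‖(z + τ • p - π) + η • p‖ ^ 2 :=
      pow_le_pow_left₀ Metric.infDist_nonneg h2 2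
    rw [norm_add_sq_real, inner_smul_right, norm_smul, Real.norm_of_nonneg hη] at h3
    have h4 : ‖z + τ • p - π‖ = Metric.infDist (z + τ • p) K := by rw [hdπ, dist_eq_norm]
    have h5 : ‖z + τ • p - π‖ ≤ s * ‖p‖ := by
      rw [h4]
      exact (hdist τ hτ).trans (by gcongr)
    rw [← h4]
    have h6 : η * inner ℝ (z + τ • p - π) p ≤ η * (ε * (s * ‖p‖)) := by
      refine mul_le_mul_of_nonneg_left (h1.trans ?_) hη
      gcongr
    nlinarith
  have hN : ∀ N : ℕ, Metric.infDist (z + s • p) K ^ 2 ≤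
      2 * ε * ‖p‖ * s ^ 2 + s ^ 2 * ‖p‖ ^ 2 * (1 / ((N : ℝ) + 1)) := by
    intro N
    set η : ℝ := s / ((N : ℝ) + 1) with hη
    have hN0 : (0 : ℝ) < (N : ℝ) + 1 := by positivity
    have hη0 : 0 ≤ η := by positivity
    have hηs : ((N : ℝ) + 1) * η = s := by
      rw [hη]; field_simp
    have hind : ∀ j : ℕ, j ≤ N + 1 → Metric.infDist (z + ((j : ℝ) * η) • p) K ^ 2 ≤
        (j : ℝ) * (2 * η * ε * (s * ‖p‖) + η ^ 2 * ‖p‖ ^ 2) := by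
      intro j
      induction j with
      | zero => intro _; simp [Metric.infDist_zero_of_mem hz]
      | succ j ih =>
        intro hj
        have hjN : (j : ℝ) ≤ (N : ℝ) + 1 := by exact_mod_cast (Nat.le_of_succ_le hj)
        have := hstep ((j : ℝ) * η) η (by positivity)
          (by rw [← hηs]; gcongr) hη0
        have ih' := ih (Nat.le_of_succ_le hj)
        push_cast
        rw [show ((j : ℝ) + 1) * η = (j : ℝ) * η + η by ring]
        linarith
    have := hind (N + 1) le_rfl
    push_cast at this
    rw [hηs] at this
    refine this.trans_eq ?_
    rw [hη]
    field_simp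
  have hlim : Tendsto (fun N : ℕ => 2 * ε * ‖p‖ * s ^ 2 + s ^ 2 * ‖p‖ ^ 2 * (1 / ((N : ℝ) + 1)))
      atTop (𝓝 (2 * ε * ‖p‖ * s ^ 2)) := by
    simpa using tendsto_const_nhds.add
      ((tendsto_one_div_add_atTop_nhds_zero_nat (𝕜 := ℝ)).const_mul (s ^ 2 * ‖p‖ ^ 2))
  exact ge_of_tendsto' hlim hN

/-- Second-order tangent directions may be perturbed by elements of the polar of the directional
normal cone. -/
theorem tendsto_infDist_div_of_mem_polar [FiniteDimensional ℝ F] {K : Set F} (hK : IsClosed K)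
    {y q p w : F} (hp : p ∈ polar (dirNormalCone K y q)) {t s : ℕ → ℝ} {W : ℕ → F}
    (ht : ∀ k, 0 < t k) (hs : ∀ k, 0 < s k) (ht0 : Tendsto t atTop (𝓝 0))
    (hst : Tendsto (fun k => s k / t k) atTop (𝓝 0)) (hW : Tendsto W atTop (𝓝 w))
    (hmem : ∀ k, y + t k • q + s k • W k ∈ K) :
    Tendsto (fun k => Metric.infDist (y + t k • q + s k • (W k + p)) K / s k) atTop (𝓝 0) := by
  have : ProperSpace F := FiniteDimensional.proper ℝ F
  have hsq : Tendsto (fun k => (Metric.infDist (y + t k • q + s k • (W k + p)) K / s k) ^ 2)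
      atTop (𝓝 0) := by
    rw [Metric.tendsto_nhds]
    intro η hη
    -- Chosen so that `2 ε ‖p‖ < η`.
    set ε : ℝ := η / (4 * (‖p‖ + 1)) with hεdef
    have hp1 : 0 < ‖p‖ + 1 := by positivity
    have hε : 0 < ε := by positivity
    obtain ⟨δ, hδ, hφ⟩ := exists_pos_forall_lt_of_pos_on_dirNormalCone (S := K) (y := y) (q := q)
      (φ := fun u => ε - inner ℝ u p) (by fun_prop)
      (fun u hu _ => by have := hp u hu; linarith)
    have hb0 : Tendsto (fun k => s k / t k * (‖W k‖ + 2 * ‖p‖)) atTop (𝓝 0) := by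
      simpa using hst.mul (hW.norm.add_const (2 * ‖p‖))
    filter_upwards [ht0.eventually_lt_const hδ, hb0.eventually_lt_const hδ] with k htk hbk
    have hest := sq_infDist_add_smul_le hK (hmem k) (hs k).le hε.le (p := p)
      (fun τ hτ hτs π hπ hdπ => ?_)
    · rw [add_assoc, ← smul_add] at hest
      rw [Real.dist_0_eq_abs, abs_of_nonneg (by positivity), div_pow,
        div_lt_iff₀ (pow_pos (hs k) 2)]
      refine hest.trans_lt ?_
      have : 2 * ε * ‖p‖ < η := by
        have : ε * (4 * (‖p‖ + 1)) = η := by rw [hεdef]; field_simp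
        nlinarith [norm_nonneg p]
      exact mul_lt_mul_of_pos_right this (pow_pos (hs k) 2)
    · rcases eq_or_ne (y + t k • q + s k • W k + τ • p) π with h | h
      · simp [h]
      obtain ⟨hu, hu1⟩ := unit_mem_frechetNormalCone_of_infDist_eq hπ hdπ h
      set z := y + t k • q + s k • W k + τ • p with hz
      have hzπ : ‖z - π‖ ≤ τ * ‖p‖ := by
        rw [← dist_eq_norm, ← hdπ]
        refine (Metric.infDist_le_dist_of_mem (hmem k)).trans ?_
        rw [hz, dist_eq_norm, add_sub_cancel_left, norm_smul, Real.norm_of_nonneg hτ]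
      have hπe : y + t k • ((t k)⁻¹ • (π - y)) = π := by
        rw [smul_smul, mul_inv_cancel₀ (ht k).ne', one_smul, add_sub_cancel]
      have heq : (t k)⁻¹ • (π - y) - q = (t k)⁻¹ • (s k • W k + τ • p - (z - π)) := by
        have : q = (t k)⁻¹ • (t k • q) := by
          rw [smul_smul, inv_mul_cancel₀ (ht k).ne', one_smul]
        conv_lhs => rw [this]
        rw [← smul_sub, hz]
        congr 1
        abel
      -- All displacements from `y + t q` are `O(s) = o(t)`, so the projection is still seen from
      -- `y` in a direction close to `q`.
      have hnear : ‖(t k)⁻¹ • (π - y) - q‖ < δ := by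
        refine lt_of_le_of_lt ?_ hbk
        rw [heq, norm_smul, norm_inv, Real.norm_of_nonneg (ht k).le]
        have h1 : ‖s k • W k + τ • p - (z - π)‖ ≤ s k * (‖W k‖ + 2 * ‖p‖) := by
          calc ‖s k • W k + τ • p - (z - π)‖ ≤ ‖s k • W k‖ + ‖τ • p‖ + ‖z - π‖ :=
                (norm_sub_le _ _).trans (by gcongr; exact norm_add_le _ _)
            _ ≤ s k * ‖W k‖ + τ * ‖p‖ + τ * ‖p‖ := by
                rw [norm_smul, norm_smul, Real.norm_of_nonneg (hs k).le, Real.norm_of_nonneg hτ]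
                gcongr
            _ ≤ s k * ‖W k‖ + s k * ‖p‖ + s k * ‖p‖ := by gcongr
            _ = s k * (‖W k‖ + 2 * ‖p‖) := by ring
        calc (t k)⁻¹ * ‖s k • W k + τ • p - (z - π)‖
            ≤ (t k)⁻¹ * (s k * (‖W k‖ + 2 * ‖p‖)) :=
              mul_le_mul_of_nonneg_left h1 (inv_nonneg.2 (ht k).le)
          _ = s k / t k * (‖W k‖ + 2 * ‖p‖) := by ring
      have hlt := hφ (t k) ((t k)⁻¹ • (π - y)) _ (ht k) htk hnear (by rwa [hπe]) hu1
      rw [real_inner_smul_left] at hlt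
      have hn : 0 < ‖z - π‖ := norm_pos_iff.2 (sub_ne_zero.2 h)
      have h2 : ‖z - π‖⁻¹ * inner ℝ (z - π) p ≤ ε := by linarith
      rwa [inv_mul_le_iff₀ hn, mul_comm] at h2
  have := hsq.sqrt
  simp only [Real.sqrt_zero] at this
  refine this.congr fun k => Real.sqrt_sq ?_
  exact div_nonneg Metric.infDist_nonneg (hs k).le

end Approximation

/-! ### Penalized distance and its first-order conditions -/

section Subregularity

/-- The penalty makes the objective coercive, so an exact minimizer plays the role of an Ekeland
point. -/
theorem exists_penalty_minimizer {E F : Type*} [NormedAddCommGroup E] [ProperSpace E]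
    [NormedAddCommGroup F] {g : E → F} (hg : Continuous g) (K : Set F)
    (a : E) {c : ℝ} (hc : 0 < c) :
    ∃ x, ∀ y, Metric.infDist (g x) K + c * ‖x - a‖ ≤ Metric.infDist (g y) K + c * ‖y - a‖ := by
  refine Continuous.exists_forall_le (f := fun y => Metric.infDist (g y) K + c * ‖y - a‖)
    (((Metric.continuous_infDist_pt K).comp hg).add (by fun_prop)) ?_
  refine tendsto_atTop_mono (f := fun y => c * dist y a) (fun y => ?_)
    ((tendsto_dist_right_cocompact_atTop a).const_mul_atTop hc)
  rw [dist_eq_norm]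
  linarith [Metric.infDist_nonneg (x := g y) (s := K)]

variable {E F : Type*} [NormedAddCommGroup E] [NormedSpace ℝ E]

theorem norm_apply_le_of_forall_le_add_norm_sub {φ : E → ℝ} {φ' : E →L[ℝ] ℝ} {x a : E} {c : ℝ}
    (hφ : HasFDerivAt φ φ' x) (hc : 0 ≤ c) (hmin : ∀ y, φ x + c * ‖x - a‖ ≤ φ y + c * ‖y - a‖)
    (v : E) : -(c * ‖v‖) ≤ φ' v := by
  have hlim := (hφ.hasLineDerivAt v).tendsto_slope_zero_right
  refine ge_of_tendsto hlim ?_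
  filter_upwards [self_mem_nhdsWithin] with t ht
  have ht : 0 < t := ht
  have h1 := hmin (x + t • v)
  have h2 : ‖x + t • v - a‖ ≤ ‖x - a‖ + t * ‖v‖ := by
    calc ‖x + t • v - a‖ = ‖(x - a) + t • v‖ := by congr 1; abel
      _ ≤ ‖x - a‖ + t * ‖v‖ := by
        refine (norm_add_le _ _).trans_eq ?_
        rw [norm_smul, Real.norm_of_nonneg ht.le]
  have h3 := mul_le_mul_of_nonneg_left h2 hc
  rw [smul_eq_mul, le_inv_mul_iff₀ ht]
  linarith

open Asymptotics in
theorem tendsto_first_order_quotient {G : Type*} [NormedAddCommGroup G] [NormedSpace ℝ G]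
    {g : E → G} {A : E →L[ℝ] G} {x d : E} (hg : HasFDerivAt g A x) {t : ℕ → ℝ} {D : ℕ → E}
    (ht : ∀ k, 0 < t k) (ht0 : Tendsto t atTop (𝓝 0)) (hD : Tendsto D atTop (𝓝 d)) :
    Tendsto (fun k => (t k)⁻¹ • (g (x + t k • D k) - g x)) atTop (𝓝 (A d)) := by
  have hw : Tendsto (fun k => t k • D k) atTop (𝓝 0) := by simpa using ht0.smul hD
  have hO : (fun k => t k • D k) =O[atTop] t := by
    simpa using (isBigO_refl t atTop).smul (hD.isBigO_one ℝ)
  have h := (((hasFDerivAt_iff_isLittleO_nhds_zero.1 hg).comp_tendsto hw).trans_isBigO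
    hO).tendsto_inv_smul_nhds_zero
  have := h.add ((A.continuous.tendsto d).comp hD)
  rw [zero_add] at this
  refine this.congr fun k => ?_
  simp only [Function.comp_apply, map_smul]
  rw [smul_sub, smul_smul, inv_mul_cancel₀ (ht k).ne', one_smul, sub_add_cancel]

variable [NormedAddCommGroup F] [InnerProductSpace ℝ F]

/-- First-order condition at a minimizer of the penalized distance outside of `K`. -/
theorem inner_unit_normal_le_of_penalty_minimizer {g : E → F} {A : E →L[ℝ] F} {K : Set F}
    {x a : E} {c : ℝ} {π : F} (hg : HasFDerivAt g A x) (hc : 0 ≤ c)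
    (hmin : ∀ y, Metric.infDist (g x) K + c * ‖x - a‖ ≤ Metric.infDist (g y) K + c * ‖y - a‖)
    (hπ : π ∈ K) (hdπ : Metric.infDist (g x) K = dist (g x) π) (hne : g x ≠ π) (v : E) :
    inner ℝ (‖g x - π‖⁻¹ • (g x - π)) (A v) ≤ c * ‖v‖ := by
  have hn : 0 < ‖g x - π‖ := norm_pos_iff.2 (sub_ne_zero.2 hne)
  -- With the projection `π` frozen, `‖g y - π‖` majorizes the distance, agrees with it at `x`, and
  -- is differentiable there because `g x ≠ π`.
  have hd := ((hg.sub_const π).norm_sq).sqrt (pow_pos hn 2).ne'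
  simp only [Real.sqrt_sq (norm_nonneg _)] at hd
  have := norm_apply_le_of_forall_le_add_norm_sub hd hc (a := a) (fun y => ?_) (-v)
  · simp only [map_neg, norm_neg, _root_.smul_apply, ContinuousLinearMap.comp_apply,
      innerSL_apply_apply, smul_eq_mul, nsmul_eq_mul, Nat.cast_ofNat] at this
    rw [real_inner_smul_left]
    have e : 1 / (2 * ‖g x - π‖) * (2 * inner ℝ (g x - π) (A v)) =
      ‖g x - π‖⁻¹ * inner ℝ (g x - π) (A v) := by field_simp
    linarith
  · have h1 := hmin y
    have h2 : Metric.infDist (g y) K ≤ dist (g y) π := Metric.infDist_le_dist_of_mem hπ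
    rw [hdπ] at h1
    rw [← dist_eq_norm (g x), ← dist_eq_norm (g y)]
    linarith

end Subregularity

/-! ### Directional subregularity along a sequence -/

section Correction

variable {E F : Type*} [NormedAddCommGroup E] [InnerProductSpace ℝ E] [FiniteDimensional ℝ E]
  [NormedAddCommGroup F] [InnerProductSpace ℝ F] [FiniteDimensional ℝ F]

/-- Directional metric subregularity along a sequence: under the directional qualification, points
`x + t D` with `D → d` that satisfy `g ∈ K` up to `o(s)` can be corrected to feasible
points by a displacement of order `o(s)`. -/
theorem exists_feasible_correction {g : E → F} (hg : ContDiff ℝ 1 g) {K : Set F}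
    (hK : IsClosed K) {x d : E} (hx : g x ∈ K)
    (hcq : ∀ u ∈ dirNormalCone K (g x) (fderiv ℝ g x d),
      (∀ v, inner ℝ u (fderiv ℝ g x v) = 0) → u = 0)
    {t s : ℕ → ℝ} {D : ℕ → E} (ht : ∀ k, 0 < t k) (hs : ∀ k, 0 < s k)
    (ht0 : Tendsto t atTop (𝓝 0)) (hst : Tendsto (fun k => s k / t k) atTop (𝓝 0))
    (hD : Tendsto D atTop (𝓝 d))
    (hinf : Tendsto (fun k => Metric.infDist (g (x + t k • D k)) K / s k) atTop (𝓝 0)) :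
    ∃ R : ℕ → E, Tendsto R atTop (𝓝 0) ∧ ∀ᶠ k in atTop, g (x + t k • D k + s k • R k) ∈ K := by
  have : ProperSpace E := FiniteDimensional.proper ℝ E
  have : ProperSpace F := FiniteDimensional.proper ℝ F
  have : CompleteSpace E := FiniteDimensional.complete ℝ E
  have : CompleteSpace F := FiniteDimensional.complete ℝ F
  set A := fderiv ℝ g x with hA
  have hgd : ∀ y, HasFDerivAt g (fderiv ℝ g y) y := fun y =>
    (hg.differentiable (by norm_num) y).hasFDerivAt
  -- The qualification makes `‖A* u‖` positive on unit directional normals; compactness turns this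
  -- into a uniform bound `δ` nearby.
  obtain ⟨δ, hδ, hφ⟩ := exists_pos_forall_lt_of_pos_on_dirNormalCone (S := K) (y := g x)
    (q := A d) (φ := fun u => ‖ContinuousLinearMap.adjoint A u‖) (by fun_prop)
    (fun u hu hu1 => norm_pos_iff.2 fun h0 => by
      have : u = 0 := hcq u hu fun v => by
        rw [← ContinuousLinearMap.adjoint_inner_left, h0, inner_zero_left]
      simp [this] at hu1)
  -- Below, `c` plus the Jacobian error `δ/4` is `3δ/4 < δ`, which rules out an infeasible
  -- minimizer.
  set c : ℝ := δ / 2 with hc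
  have hc0 : 0 < c := by positivity
  choose X hX using fun k => exists_penalty_minimizer hg.continuous K (x + t k • D k) hc0
  choose P hPK hPd using fun k => hK.exists_infDist_eq_dist ⟨g x, hx⟩ (g (X k))
  set R : ℕ → E := fun k => (s k)⁻¹ • (X k - (x + t k • D k)) with hR
  have hXR : ∀ k, X k = x + t k • D k + s k • R k := fun k => by
    rw [hR, smul_smul, mul_inv_cancel₀ (hs k).ne', one_smul, add_sub_cancel]
  -- Comparison with the unperturbed point bounds the displacement by `c⁻¹` times its infeasibility,
  -- hence by `o(s)`.
  have hmin : ∀ k, Metric.infDist (g (X k)) K + c * ‖X k - (x + t k • D k)‖ ≤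
      Metric.infDist (g (x + t k • D k)) K := fun k => by
    simpa using hX k (x + t k • D k)
  have hR0 : Tendsto R atTop (𝓝 0) := by
    refine squeeze_zero_norm (a := fun k => c⁻¹ * (Metric.infDist (g (x + t k • D k)) K / s k))
      (fun k => ?_) (by simpa using hinf.const_mul c⁻¹)
    rw [hR, norm_smul, norm_inv, Real.norm_of_nonneg (hs k).le, inv_mul_le_iff₀ (hs k)]
    have h1 : c * ‖X k - (x + t k • D k)‖ ≤ Metric.infDist (g (x + t k • D k)) K := by
      linarith [hmin k, Metric.infDist_nonneg (x := g (X k)) (s := K)]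
    have h2 : s k * (c⁻¹ * (Metric.infDist (g (x + t k • D k)) K / s k)) =
        c⁻¹ * Metric.infDist (g (x + t k • D k)) K := by
      have := (hs k).ne'
      field_simp
    rw [h2, le_inv_mul_iff₀ hc0]
    exact h1
  refine ⟨R, hR0, ?_⟩
  set D' : ℕ → E := fun k => D k + (s k / t k) • R k with hD'
  have hD'0 : Tendsto D' atTop (𝓝 d) := by simpa using hD.add (hst.smul hR0)
  have hXD : ∀ k, X k = x + t k • D' k := fun k => by
    rw [hXR, hD', smul_add, smul_smul (t k), mul_div_cancel₀ _ (ht k).ne', add_assoc]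
  have hXx : Tendsto X atTop (𝓝 x) := by
    have : Tendsto (fun k => x + t k • D' k) atTop (𝓝 x) := by
      simpa using tendsto_const_nhds.add (ht0.smul hD'0)
    exact this.congr fun k => (hXD k).symm
  set e : ℕ → F := fun k => (t k)⁻¹ • (P k - g x) with he
  have hPe : ∀ k, g x + t k • e k = P k := fun k => by
    rw [he, smul_smul, mul_inv_cancel₀ (ht k).ne', one_smul, add_sub_cancel]
  have heq : Tendsto e atTop (𝓝 (A d)) := by
    have h1 := tendsto_first_order_quotient (hgd x) ht ht0 hD'0
    have h2 : Tendsto (fun k => (t k)⁻¹ • (P k - g (X k))) atTop (𝓝 0) := by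
      refine squeeze_zero_norm
        (a := fun k => s k / t k * (Metric.infDist (g (x + t k • D k)) K / s k))
        (fun k => ?_) (by simpa using hst.mul hinf)
      rw [norm_smul, norm_inv, Real.norm_of_nonneg (ht k).le, inv_mul_le_iff₀ (ht k),
        ← dist_eq_norm, dist_comm, ← hPd k]
      have h3 : t k * (s k / t k * (Metric.infDist (g (x + t k • D k)) K / s k)) =
          Metric.infDist (g (x + t k • D k)) K := by
        have := (hs k).ne'
        have := (ht k).ne'
        field_simp
      rw [h3]
      have := mul_nonneg hc0.le (norm_nonneg (X k - (x + t k • D k)))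
      linarith [hmin k]
    have := h2.add h1
    rw [zero_add] at this
    refine this.congr fun k => ?_
    rw [← hXD k, ← smul_add, he, sub_add_sub_cancel]
  have hAk : Tendsto (fun k => ‖A - fderiv ℝ g (X k)‖) atTop (𝓝 0) := by
    have h1 : Tendsto (fun k => fderiv ℝ g (X k)) atTop (𝓝 A) :=
      ((hg.continuous_fderiv (by norm_num)).tendsto x).comp hXx
    simpa using ((tendsto_const_nhds (x := A)).sub h1).norm
  have heδ : ∀ᶠ k in atTop, ‖e k - A d‖ < δ :=
    (tendsto_iff_norm_sub_tendsto_zero.1 heq).eventually_lt_const hδ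
  filter_upwards [ht0.eventually_lt_const hδ, heδ,
    hAk.eventually_lt_const (show 0 < δ / 4 by positivity)] with k htk hek hAkk
  rw [← hXR k]
  by_contra hnot
  have hne : g (X k) ≠ P k := fun h => hnot (h ▸ hPK k)
  obtain ⟨hu, hu1⟩ := unit_mem_frechetNormalCone_of_infDist_eq (hPK k) (hPd k) hne
  have hfoc := inner_unit_normal_le_of_penalty_minimizer (hgd (X k)) hc0.le (hX k) (hPK k) (hPd k)
    hne
  set u := ‖g (X k) - P k‖⁻¹ • (g (X k) - P k) with hudef
  have hlow := hφ (t k) (e k) u (ht k) htk hek (by rwa [hPe k]) hu1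
  -- Testing stationarity with `v = A* u` gives `‖v‖² ≤ (3δ/4) ‖v‖`, against `‖v‖ > δ`.
  set v := ContinuousLinearMap.adjoint A u with hv
  have h1 : ‖v‖ ^ 2 = inner ℝ u (A v) := by
    rw [← real_inner_self_eq_norm_sq]
    conv_lhs => rw [hv, ContinuousLinearMap.adjoint_inner_left]
  have h2 : inner ℝ u (A v) = inner ℝ u (fderiv ℝ g (X k) v)
      + inner ℝ u ((A - fderiv ℝ g (X k)) v) := by
    rw [← inner_add_right, _root_.sub_apply, add_sub_cancel]
  have h3 : inner ℝ u ((A - fderiv ℝ g (X k)) v) ≤ δ / 4 * ‖v‖ := by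
    calc inner ℝ u ((A - fderiv ℝ g (X k)) v) ≤ ‖u‖ * ‖(A - fderiv ℝ g (X k)) v‖ :=
          real_inner_le_norm _ _
      _ = ‖(A - fderiv ℝ g (X k)) v‖ := by rw [hu1, one_mul]
      _ ≤ ‖A - fderiv ℝ g (X k)‖ * ‖v‖ := ContinuousLinearMap.le_opNorm _ _
      _ ≤ δ / 4 * ‖v‖ := by gcongr
  have h4 := hfoc v
  have h5 : ‖v‖ * ‖v‖ ≤ (3 / 4 * δ) * ‖v‖ := by nlinarith
  have h6 : 0 < ‖v‖ := hδ.trans hlow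
  have h7 := le_of_mul_le_mul_right h5 h6
  linarith

end Correction

/-! ### Primal condition and multipliers -/

section Multipliers

/-- The cone inequality is homogeneous in `t`, and for `d ≠ 0` it holds strictly in the limit `e =
d`. -/
theorem eventually_smul_mem_dirNhd {E : Type*} [NormedAddCommGroup E] [InnerProductSpace ℝ E]
    {ρ δ : ℝ} (hρ : 0 < ρ) (hδ : 0 < δ) {d : E} {t : ℕ → ℝ} {e : ℕ → E} (ht : ∀ k, 0 < t k)
    (ht0 : Tendsto t atTop (𝓝 0)) (he : Tendsto e atTop (𝓝 d)) :
    ∀ᶠ k in atTop, t k • e k ∈ dirNhd ρ δ d := by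
  have h1 : Tendsto (fun k => ‖t k • e k‖) atTop (𝓝 0) := by
    simpa using (ht0.smul he).norm
  have h2 : ∀ᶠ k in atTop, ‖‖d‖ • e k - ‖e k‖ • d‖ ≤ ρ * ‖e k‖ * ‖d‖ := by
    rcases eq_or_ne d 0 with rfl | hd
    · simp
    · have hn : 0 < ‖d‖ := norm_pos_iff.2 hd
      have hl : Tendsto (fun k => ‖‖d‖ • e k - ‖e k‖ • d‖) atTop (𝓝 0) := by
        simpa using ((he.const_smul ‖d‖).sub (he.norm.smul_const d)).norm
      have hr : Tendsto (fun k => ρ * ‖e k‖ * ‖d‖) atTop (𝓝 (ρ * ‖d‖ * ‖d‖)) :=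
        (he.norm.const_mul ρ).mul_const ‖d‖
      exact (hl.eventually_lt hr (by positivity)).mono fun k hk => hk.le
  filter_upwards [h1.eventually_le_const hδ, h2] with k hk1 hk2
  refine ⟨hk1, ?_⟩
  rw [norm_smul, Real.norm_of_nonneg (ht k).le, smul_comm, mul_smul, ← smul_sub, norm_smul,
    Real.norm_of_nonneg (ht k).le]
  calc t k * ‖‖d‖ • e k - ‖e k‖ • d‖ ≤ t k * (ρ * ‖e k‖ * ‖d‖) :=
        mul_le_mul_of_nonneg_left hk2 (ht k).le
    _ = ρ * (t k * ‖e k‖) * ‖d‖ := by ring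

variable {E F : Type*} [NormedAddCommGroup E] [InnerProductSpace ℝ E]
  [NormedAddCommGroup F] [InnerProductSpace ℝ F]

/-- `w` is the limit of second-order quotients of arcs `y + t q + s U` in `S` with
`t² / 2s → θ`. For `θ = 0` these are the asymptotic second-order tangents, and
`θ = 1` contains the second-order tangents. -/
def IsArcTangent (S : Set F) (y q : F) (θ : ℝ) (w : F) : Prop :=
  ∃ (t s : ℕ → ℝ) (U : ℕ → F), (∀ k, 0 < t k) ∧ (∀ k, 0 < s k) ∧ Tendsto t atTop (𝓝 0) ∧
    Tendsto (fun k => s k / t k) atTop (𝓝 0) ∧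
    Tendsto (fun k => 1 / 2 * t k ^ 2 / s k) atTop (𝓝 θ) ∧ Tendsto U atTop (𝓝 w) ∧
    ∀ k, y + t k • q + s k • U k ∈ S

theorem isArcTangent_zero_of_mem_asymptoticTangentCone {S : Set F} {y q w : F}
    (hw : w ∈ asymptoticTangentCone S y q) : IsArcTangent S y q 0 w := by
  obtain ⟨t, r, U, ht, hr, ht0, hr0, htr, hU, hS⟩ := hw
  -- With this `s`, the ratio `t² / (2s)` is exactly `t / r`, hence `θ = 0`.
  refine ⟨t, fun k => 1 / 2 * t k * r k, U, ht, fun k => ?_, ht0, ?_, ?_, hU, hS⟩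
  · have := ht k; have := hr k; positivity
  · have : Tendsto (fun k => 1 / 2 * r k) atTop (𝓝 0) := by
      simpa only [mul_zero] using hr0.const_mul (1 / 2 : ℝ)
    refine this.congr fun k => ?_
    have := (ht k).ne'
    field_simp
  · refine htr.congr fun k => ?_
    have := (ht k).ne'
    have := (hr k).ne'
    field_simp

theorem isArcTangent_one_of_mem_secondOrderTangentSet {S : Set F} {y q w : F}
    (hw : w ∈ secondOrderTangentSet S y q) : IsArcTangent S y q 1 w := by
  obtain ⟨t, U, ht, ht0, hU, hS⟩ := hw
  refine ⟨t, fun k => 1 / 2 * t k ^ 2, U, ht, fun k => ?_, ht0, ?_, ?_, hU, hS⟩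
  · have := ht k; positivity
  · have : Tendsto (fun k => 1 / 2 * t k) atTop (𝓝 0) := by
      simpa only [mul_zero] using ht0.const_mul (1 / 2 : ℝ)
    refine this.congr fun k => ?_
    have := (ht k).ne'
    field_simp
  · refine tendsto_const_nhds.congr fun k => ?_
    have := (ht k).ne'
    field_simp

/-- Images under the differential of feasible directions are directions tangent to the
constraint set. -/
theorem fderiv_mem_tangentCone {g : E → F} {A : E →L[ℝ] F} {K : Set F} {x d : E}
    (hg : HasFDerivAt g A x) (hd : d ∈ tangentCone (g ⁻¹' K) x) : A d ∈ tangentCone K (g x) := by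
  obtain ⟨t, e, ht, ht0, he, hmem⟩ := hd
  refine ⟨t, _, ht, ht0, tendsto_first_order_quotient hg ht ht0 he, fun k => ?_⟩
  rw [smul_smul, mul_inv_cancel₀ (ht k).ne', one_smul, add_sub_cancel]
  exact hmem k

theorem fderiv_lagrangian {f : E → ℝ} {g : E → F} (hf : Differentiable ℝ f)
    (hg : Differentiable ℝ g) (l : F) (y : E) :
    fderiv ℝ (fun y => lagrangian f g y l) y = fderiv ℝ f y + innerSL ℝ l ∘L fderiv ℝ g y :=
  ((hf y).hasFDerivAt.add ((innerSL ℝ l).hasFDerivAt.comp y (hg y).hasFDerivAt)).fderiv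

theorem lagrangianHess_eq {f : E → ℝ} {g : E → F} (hf : ContDiff ℝ 2 f) (hg : ContDiff ℝ 2 g)
    (l : F) (x d : E) :
    lagrangianHess f g x l d =
      fderiv ℝ (fderiv ℝ f) x d d + inner ℝ l (fderiv ℝ (fderiv ℝ g) x d d) := by
  have hf1 := hf.differentiable (by norm_num)
  have hg1 := hg.differentiable (by norm_num)
  have hf2 := (hf.fderiv_right (m := 1) (by norm_num)).differentiable (by norm_num) x
  have hg2 := (hg.fderiv_right (m := 1) (by norm_num)).differentiable (by norm_num) x
  have h := hf2.hasFDerivAt.add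
    ((hasFDerivAt_const (innerSL ℝ l) x).clm_comp hg2.hasFDerivAt)
  rw [lagrangianHess, funext (fderiv_lagrangian hf1 hg1 l)]
  erw [h.fderiv]
  simp

variable [FiniteDimensional ℝ E] [FiniteDimensional ℝ F]

/-- Primal second-order necessary condition. -/
theorem nonneg_of_isArcTangent {f : E → ℝ} {g : E → F} {K : Set F} (hf : ContDiff ℝ 2 f)
    (hg : ContDiff ℝ 2 g) (hK : IsClosed K) {x d : E} (hmin : IsDirLocalMin f (g ⁻¹' K) x d)
    (hfd : fderiv ℝ f x d = 0)
    (hcq : ∀ u ∈ dirNormalCone K (g x) (fderiv ℝ g x d),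
      (∀ v, inner ℝ u (fderiv ℝ g x v) = 0) → u = 0)
    {θ : ℝ} {v : E} {w p : F} (hw : IsArcTangent K (g x) (fderiv ℝ g x d) θ w)
    (hp : p ∈ polar (dirNormalCone K (g x) (fderiv ℝ g x d)))
    (hv : fderiv ℝ g x v + θ • fderiv ℝ (fderiv ℝ g) x d d = w + p) :
    0 ≤ fderiv ℝ f x v + θ * fderiv ℝ (fderiv ℝ f) x d d := by
  obtain ⟨t, s, U, ht, hs, ht0, hst, hθ, hU, hmem⟩ := hw
  obtain ⟨hx, ρ, δ, hρ, hδ, hopt⟩ := hmin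
  have hgQ := tendsto_second_order_quotient hg (x := x) (d := d) (V := fun _ => v) ht hs ht0 hst hθ
    tendsto_const_nhds
  rw [hv] at hgQ
  set q := fderiv ℝ g x d with hq
  set D : ℕ → E := fun k => d + (s k / t k) • v with hD
  have hDt : ∀ k, t k • D k = t k • d + s k • v := fun k => by
    rw [hD, smul_add, smul_smul (t k), mul_div_cancel₀ _ (ht k).ne']
  have hD0 : Tendsto D atTop (𝓝 d) := by
    simpa using tendsto_const_nhds.add (hst.smul_const v)
  -- By `hv` the image of `x + t d + s v` and the arc shifted by `p` have the same second-order
  -- limit, so they differ by `o(s)`.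
  have hinf : Tendsto (fun k => Metric.infDist (g (x + t k • D k)) K / s k) atTop (𝓝 0) := by
    have h1 := tendsto_infDist_div_of_mem_polar hK hp ht hs ht0 hst hU hmem
    have h2 := (hgQ.sub (hU.add_const p)).norm
    rw [sub_self, norm_zero] at h2
    refine squeeze_zero (fun k => div_nonneg Metric.infDist_nonneg (hs k).le) (fun k => ?_)
      (by simpa only [add_zero] using h1.add h2)
    rw [div_le_iff₀ (hs k), add_mul, div_mul_cancel₀ _ (hs k).ne']
    refine (Metric.infDist_le_infDist_add_dist
      (y := g x + t k • q + s k • (U k + p))).trans_eq ?_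
    congr 1
    rw [dist_eq_norm, mul_comm, ← Real.norm_of_nonneg (hs k).le, ← norm_smul,
      Real.norm_of_nonneg (hs k).le, smul_sub (s k), smul_smul, mul_inv_cancel₀ (hs k).ne',
      one_smul, hDt, ← add_assoc]
    congr 1
    abel
  obtain ⟨R, hR, hfeas⟩ := exists_feasible_correction (hg.of_le (by norm_num)) hK hx hcq ht hs ht0
    hst hD0 hinf
  have hvR : Tendsto (fun k => v + R k) atTop (𝓝 v) := by
    simpa using tendsto_const_nhds.add hR
  have hfQ := tendsto_second_order_quotient hf (x := x) (d := d) ht hs ht0 hst hθ hvR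
  have he : Tendsto (fun k => d + (s k / t k) • (v + R k)) atTop (𝓝 d) := by
    simpa using tendsto_const_nhds.add (hst.smul hvR)
  rw [← smul_eq_mul]
  refine ge_of_tendsto hfQ ?_
  filter_upwards [hfeas, eventually_smul_mem_dirNhd hρ hδ ht ht0 he] with k hk hnhd
  rw [smul_add, smul_smul, mul_div_cancel₀ _ (ht k).ne'] at hnhd
  rw [hDt, ← add_assoc, add_assoc _ (s k • v), ← smul_add] at hk
  have hle := hopt (x + t k • d + s k • (v + R k)) hk (by rwa [add_assoc, add_sub_cancel_left])
  rw [hfd, smul_zero, sub_zero]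
  exact smul_nonneg (inv_nonneg.2 (hs k).le) (sub_nonneg.2 hle)

/-- Second-order optimality with a single multiplier for a convex set of arc tangents. -/
theorem exists_clarkeMultiplier {f : E → ℝ} {g : E → F} {K : Set F} (hf : ContDiff ℝ 2 f)
    (hg : ContDiff ℝ 2 g) (hK : IsClosed K) {x d : E} (hd : d ∈ tangentCone (g ⁻¹' K) x)
    (hmin : IsDirLocalMin f (g ⁻¹' K) x d) (hfd : fderiv ℝ f x d = 0)
    (hcq : ∀ u ∈ dirClarkeNormalCone K (g x) (fderiv ℝ g x d),
      (∀ v, inner ℝ u (fderiv ℝ g x v) = 0) → u = 0)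
    {θ : ℝ} {W : Set F} (hWne : W.Nonempty) (hW : Convex ℝ W)
    (hWarc : ∀ w ∈ W, IsArcTangent K (g x) (fderiv ℝ g x d) θ w) :
    ∃ l ∈ clarkeMultipliers f g K x d, ∀ w ∈ W, inner ℝ l w ≤ θ * lagrangianHess f g x l d := by
  have : CompleteSpace F := FiniteDimensional.complete ℝ F
  have hf1 := hf.differentiable (by norm_num)
  have hg1 := hg.differentiable (by norm_num)
  set N := dirNormalCone K (g x) (fderiv ℝ g x d) with hN
  have hbip : ∀ l ∈ polar (polar N), l ∈ dirClarkeNormalCone K (g x) (fderiv ℝ g x d) :=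
    fun l hl => mem_closure_convexHull_of_mem_polar_polar
      (zero_mem_dirNormalCone (fderiv_mem_tangentCone (hg1 x).hasFDerivAt hd))
      (fun c hc u hu => smul_mem_dirNormalCone hu hc) hl
  obtain ⟨l, hl, hstat, hle⟩ := exists_multiplier (fderiv ℝ g x) (fderiv ℝ f x)
    -- The primal inequality needs the qualification only on limiting normals; the Clarke version is
    -- needed on the bipolar, to exclude `μ = 0`.
    (θ * fderiv ℝ (fderiv ℝ f) x d d) (θ • fderiv ℝ (fderiv ℝ g) x d d) N W hW hWne
    (fun v w hw p hp h => nonneg_of_isArcTangent hf hg hK hmin hfd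
      (fun u hu => hcq u (subset_closure (subset_convexHull ℝ _ hu))) (hWarc w hw) hp h)
    (fun l hl => hcq l (hbip l hl))
  refine ⟨l, ⟨hbip l hl, ?_⟩, fun w hw => ?_⟩
  · rw [fderiv_lagrangian hf1 hg1]
    ext v
    simpa using hstat v
  · rw [lagrangianHess_eq hf hg, mul_add]
    simpa only [inner_smul_right] using hle w hw

end Multipliers

end DirOpt

open DirOpt in
theorem corollary4p10 {n m : ℕ}
    (f : EuclideanSpace ℝ (Fin n) → ℝ)
    (g : EuclideanSpace ℝ (Fin n) → EuclideanSpace ℝ (Fin m))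
    (K : Set (EuclideanSpace ℝ (Fin m)))
    (hf : ContDiff ℝ 2 f) (hg : ContDiff ℝ 2 g) (hK : IsClosed K)
    (x d : EuclideanSpace ℝ (Fin n))
    (hd : d ∈ tangentCone (g ⁻¹' K) x)
    (hmin : IsDirLocalMin f (g ⁻¹' K) x d)
    (hfd : fderiv ℝ f x d = 0)
    (hcq : DirRCQ g K x d) :
    (∀ Kd : Set (EuclideanSpace ℝ (Fin m)), Kd.Nonempty → Convex ℝ Kd →
      Kd ⊆ asymptoticTangentCone K (g x) (fderiv ℝ g x d) →
      ∃ l ∈ clarkeMultipliers f g K x d, supportFun Kd l ≤ 0) ∧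
    ((secondOrderTangentSet K (g x) (fderiv ℝ g x d)).Nonempty →
      ∀ Kd : Set (EuclideanSpace ℝ (Fin m)), Kd.Nonempty → Convex ℝ Kd →
      Kd ⊆ secondOrderTangentSet K (g x) (fderiv ℝ g x d) →
      ∃ l ∈ clarkeMultipliers f g K x d,
        0 ≤ ((lagrangianHess f g x l d : ℝ) : EReal) - supportFun Kd l) := by
  have hcq' : ∀ u ∈ dirClarkeNormalCone K (g x) (fderiv ℝ g x d),
      (∀ v, inner ℝ u (fderiv ℝ g x v) = 0) → u = 0 := fun u hu h =>
    hcq u hu (ext_inner_right ℝ fun v => by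
      rw [ContinuousLinearMap.adjoint_inner_left, h, inner_zero_left])
  refine ⟨fun Kd hne hconv hsub => ?_, fun _ Kd hne hconv hsub => ?_⟩
  · obtain ⟨l, hl, hle⟩ := exists_clarkeMultiplier hf hg hK hd hmin hfd hcq' hne hconv
      fun w hw => isArcTangent_zero_of_mem_asymptoticTangentCone (hsub hw)
    refine ⟨l, hl, iSup₂_le fun w hw => ?_⟩
    have := hle w hw
    rw [zero_mul] at this
    exact_mod_cast this
  · obtain ⟨l, hl, hle⟩ := exists_clarkeMultiplier hf hg hK hd hmin hfd hcq' hne hconv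
      fun w hw => isArcTangent_one_of_mem_secondOrderTangentSet (hsub hw)
    -- The Hessian value is finite, so the extended-real difference is never of the form `∞ - ∞`.
    refine ⟨l, hl, (EReal.sub_nonneg (Or.inl (EReal.coe_ne_top _))
      (Or.inl (EReal.coe_ne_bot _))).2 (iSup₂_le fun w hw => ?_)⟩
    have := hle w hw
    rw [one_mul] at this
    exact_mod_cast this
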